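/- Let $d\ge 2$. A state of a $d\otimes d$ system is a positive semidefinite $d^2\times d^2$ matrix of trace one; it is separable if it is a finite convex combination of product states $\sigma\otimes\tau$, and entangled otherwise. A canonical basis is a family $(G_a)_{0\le a<d^2}$ of complex $d\times d$ matrices that is orthonormal for the Hilbert–Schmidt inner product, with $G_0=I_d/\sqrt d$ and with $G_a$ traceless for $a\neq 0$. Fix two canonical bases $(G_a^A)$ and $(G_b^B)$. For a state $\rho$ let $C^{can}(\rho)$ be the $d^2\times d^2$ correlation matrix with entries $C^{can}_{a,b}=\operatorname{Tr}(\rho\,G^A_a\otimes G^B_b)$, viewed as an operator on $\mathbb C^d\otimes\mathbb C^d$ by identifying the labels $0,\dots,d^2-1$ with the product basis vectors in lexicographic order. Let $\operatorname{Tr}_A\rho$ be the partial trace over the first factor, let $\lambda_{\max}(\rho)$ be the largest eigenvalue of $\rho$, put $k(\rho)=\det(I_d+\operatorname{Tr}_A\rho)-\det(I_{d^2}+\rho)$ and $$W_L^{CCNR}(\rho)=\bigl(1-d^2(d+1)^2k(\rho)\bigr)I_{d^2}-\frac{1}{\lambda_{\max}(\rho)}\,C^{can}(\rho).$$ Then $W_L^{CCNR}$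 is a linear entanglement witness for the state under investigation, in the following sense. (0) For every state $\rho$, $W_L^{CCNR}(\rho)$ is Hermitian if and only if $C^{can}(\rho)$ is. (i) $\operatorname{Re}\operatorname{Tr}\bigl(W_L^{CCNR}(\rho)\,\rho\bigr)\ge 0$ for every separable state $\rho$. (ii) $\operatorname{Re}\operatorname{Tr}\bigl(W_L^{CCNR}(\rho)\,\rho\bigr)<0$ for at least one entangled state $\rho$. (The real part is superfluous whenever $W_L^{CCNR}(\rho)$ is Hermitian, the trace then being real.) Moreover, for $d=2$, with the canonical basis $I/\sqrt2,X/\sqrt2,Y/\sqrt2,Z/\sqrt2$ (normalized Pauli matrices, in this order) on both sides, the state $$\rho^{(1)}=\begin{pmatrix}0.265822&0&0&0\\0&0.367089&-0.367089&0\\0&-0.367089&0.367089&0\\0&0&0&0\end{pmatrix}$$ (in the basis $|00\rangle,|01\rangle,|10\rangle,|11\rangle$) is entangled, $W_L^{CCNR}(\rho^{(1)})$ is Hermitian, and $\operatorname{Tr}\bigl(W_L^{CCNR}(\rho^{(1)})\,\rho^{(1)}\bigr)=-0.152209$ to six decimals, that is, with an error less than $5\cdot10^{-7}$. -/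

import Mathlib

open Matrix
open scoped Kronecker ComplexOrder

noncomputable section

/-- Operators on `ℂ^d ⊗ ℂ^d`, as matrices in the product basis `|i j⟩`. -/
abbrev BipartiteOp (d : ℕ) : Type := Matrix (Fin d × Fin d) (Fin d × Fin d) ℂ

/-- Density operators (states): positive semidefinite matrices of trace one. -/
def IsDensity {n : Type*} [Fintype n] (ρ : Matrix n n ℂ) : Prop :=
  ρ.PosSemidef ∧ ρ.trace = 1

/-- Separable states of a `d ⊗ d` system: finite convex combinations of product states. -/
def IsSeparableState {d : ℕ} (ρ : BipartiteOp d) : Prop :=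
  ρ ∈ convexHull ℝ
    {P : BipartiteOp d | ∃ σ τ : Matrix (Fin d) (Fin d) ℂ, IsDensity σ ∧ IsDensity τ ∧ P = σ ⊗ₖ τ}

/-- Entangled states: the states that are not separable. -/
def IsEntangled {d : ℕ} (ρ : BipartiteOp d) : Prop :=
  IsDensity ρ ∧ ¬ IsSeparableState ρ

/-- The partial trace over the first subsystem `A`. -/
def partialTraceA {d : ℕ} (ρ : BipartiteOp d) : Matrix (Fin d) (Fin d) ℂ :=
  Matrix.of fun i j => ∑ a : Fin d, ρ (a, i) (a, j)

/-- The largest (real) eigenvalue. For a Hermitian matrix of positive size the real spectrum is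
the nonempty finite set of all its eigenvalues. -/
def lambdaMax {n : Type*} [Fintype n] [DecidableEq n] (A : Matrix n n ℂ) : ℝ :=
  sSup (spectrum ℝ A)

/-- A canonical operator basis of the `d × d` matrices: `d ^ 2` matrices, orthonormal for the
Hilbert–Schmidt inner product, whose first member is `I / √d`, the others being traceless.
The `d ^ 2` labels `0, …, d ^ 2 - 1` are written in base `d`, as pairs in `Fin d × Fin d`
in lexicographic order, so that label `0` is `(0, 0)`. -/
structure IsCanonicalBasis {d : ℕ} [NeZero d]
    (G : Fin d × Fin d → Matrix (Fin d) (Fin d) ℂ) : Prop where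
  first : G (0, 0) = (((√(d : ℝ))⁻¹ : ℝ) : ℂ) • (1 : Matrix (Fin d) (Fin d) ℂ)
  traceless : ∀ a, a ≠ (0, 0) → (G a).trace = 0
  orthonormal : ∀ a b, ((G a)ᴴ * G b).trace = if a = b then 1 else 0

/-- The correlation matrix `C a b = Tr (ρ (GA a ⊗ GB b))`. It is a `d ^ 2 × d ^ 2` matrix;
row and column labels are identified with the product basis labels lexicographically. -/
def correlationMatrix {d : ℕ} (GA GB : Fin d × Fin d → Matrix (Fin d) (Fin d) ℂ)
    (ρ : BipartiteOp d) : BipartiteOp d :=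
  Matrix.of fun a b => (ρ * (GA a ⊗ₖ GB b)).trace

/-- The number `k = det (I + Tr_A ρ) - det (I + ρ)`. -/
def kConst {d : ℕ} (ρ : BipartiteOp d) : ℂ :=
  (1 + partialTraceA ρ).det - (1 + ρ).det

/-- The operator `(1 - d² (d+1)² k) I - C / λ_max(ρ)` built from the state `ρ`. -/
def wCCNR {d : ℕ} (GA GB : Fin d × Fin d → Matrix (Fin d) (Fin d) ℂ)
    (ρ : BipartiteOp d) : BipartiteOp d :=
  (1 - (d : ℂ) ^ 2 * ((d : ℂ) + 1) ^ 2 * kConst ρ) • (1 : BipartiteOp d)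
    - (((lambdaMax ρ)⁻¹ : ℝ) : ℂ) • correlationMatrix GA GB ρ

/-- The expectation value `Re Tr (W ρ)`; for Hermitian `W` and a state `ρ` the trace is real. -/
def expectation {d : ℕ} (W ρ : BipartiteOp d) : ℝ := (W * ρ).trace.re

/-- The normalized Pauli basis `I, X, Y, Z` (each divided by `√2`), in this order. -/
def pauliBasis : Fin 2 × Fin 2 → Matrix (Fin 2) (Fin 2) ℂ := fun a =>
  (((√(2 : ℝ))⁻¹ : ℝ) : ℂ) •
    ((![![!![1, 0; 0, 1], !![0, 1; 1, 0]],
        ![!![0, -Complex.I; Complex.I, 0], !![1, 0; 0, -1]]] :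
      Fin 2 → Fin 2 → Matrix (Fin 2) (Fin 2) ℂ) a.1 a.2)

/-- The two-qubit state of the example, in the ordered basis `|00⟩, |01⟩, |10⟩, |11⟩`. -/
def rhoExample : BipartiteOp 2 :=
  (!![0.265822, 0, 0, 0;
      0, 0.367089, -0.367089, 0;
      0, -0.367089, 0.367089, 0;
      0, 0, 0, 0] : Matrix (Fin (2 * 2)) (Fin (2 * 2)) ℂ).submatrix
    finProdFinEquiv finProdFinEquiv

end

/-! The expectation is `1 - d²(d+1)² Re k - Re Tr(C ρ)/λ_max`, so on separable states it suffices
that `Re Tr(C ρ) ≤ λ_max` and `Re k ≤ 0`.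

The first bound is the realignment criterion. A product state has correlation matrix `u vᵀ` with
`u`, `v` of norm at most one (Bessel, and purity at most one), so its trace against `ρ` is at most
`λ_max`; convexity does the rest.

For the second, split `ρ` into product vectors, `ρ = X Xᴴ`, with columns `A_k ⊗ B_k` of `X`, each
`A_k` a unit vector and the weights absorbed into `B`. Then `Tr_A ρ = B Bᴴ`, and passing to Gram
matrices turns `1 + Xᴴ X` into the Hadamard product of `Aᴴ A` and `1 + Bᴴ B`. As `Aᴴ A` has unit
diagonal, Oppenheim's inequality gives `det (1 + Tr_A ρ) ≤ det (1 + ρ)`.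

A state with negative expectation is therefore entangled. The maximally entangled state is one for
every `d ≥ 2`: there `k = (1 + 1/d)^d - 2 ≥ 1/4` with coefficient at least 36, which outweighs the
two remaining terms, together at most 2. -/

/-! ### Oppenheim's inequality -/

/-- If `N = ∑ μ j • K j` with `K j` positive semidefinite of trace one and `∑ K j = 1`, then the
spectrum of `N` is a doubly stochastic average of `μ`, so `∏ μ j ≤ det N`. -/
theorem prod_le_det_of_resolution {n : Type*} [Fintype n] [DecidableEq n]
    {N : Matrix n n ℂ} (hN : N.IsHermitian) (μ : n → ℝ) (hμ : ∀ j, 0 ≤ μ j)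
    (K : n → Matrix n n ℂ) (hK : ∀ j, (K j).PosSemidef) (hsum : ∑ j, K j = 1)
    (htr : ∀ j, (K j).trace = 1) (hNK : N = ∑ j, (μ j : ℂ) • K j) :
    ∏ j, μ j ≤ N.det.re := by
  set W : Matrix n n ℂ := (hN.eigenvectorUnitary).1 with hW
  have hWW : Wᴴ * W = 1 := by
    rw [← star_eq_conjTranspose, hW]; exact Unitary.coe_star_mul_self _
  have hWW' : W * Wᴴ = 1 := by
    rw [← star_eq_conjTranspose, hW]; exact Unitary.coe_mul_star_self _
  have hdiag : Wᴴ * N * W = diagonal (fun i => (hN.eigenvalues i : ℂ)) := by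
    have := hN.conjStarAlgAut_star_eigenvectorUnitary
    rw [Unitary.conjStarAlgAut_star_apply] at this
    exact this
  -- `D i j` is the quadratic form of `K j` at the `i`-th eigenvector of `N`. Rows sum to one
  -- because `∑ K j = 1`, columns because each `K j` has trace one.
  set D : n → n → ℝ := fun i j => ((Wᴴ * K j * W) i i).re with hD
  have hDim : ∀ i j, (Wᴴ * K j * W) i i = (D i j : ℂ) := fun i j => by
    have h := ((hK j).conjTranspose_mul_mul_same W).diag_nonneg (i := i)
    exact (Complex.eq_re_of_ofReal_le (r := 0) (by simpa using h))
  have hD0 : ∀ i j, 0 ≤ D i j := fun i j => by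
    have h := ((hK j).conjTranspose_mul_mul_same W).diag_nonneg (i := i)
    exact (Complex.nonneg_iff.1 h).1
  have hrow : ∀ i, ∑ j, D i j = 1 := fun i => by
    have h : ∑ j, (Wᴴ * K j * W) i i = 1 := by
      rw [← Matrix.sum_apply, ← Finset.sum_mul, ← Finset.mul_sum, hsum, mul_one, hWW, one_apply_eq]
    simp_rw [hDim] at h
    exact_mod_cast h
  have hcol : ∀ j, ∑ i, D i j = 1 := fun j => by
    have h : (Wᴴ * K j * W).trace = 1 := by
      rw [trace_mul_cycle, hWW', one_mul, htr]
    simp only [trace, diag_apply, hDim] at h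
    exact_mod_cast h
  have heig : ∀ i, hN.eigenvalues i = ∑ j, D i j * μ j := fun i => by
    have h : (Wᴴ * N * W) i i = ∑ j, (μ j : ℂ) * (Wᴴ * K j * W) i i := by
      rw [hNK, Finset.mul_sum, Finset.sum_mul, Matrix.sum_apply]
      simp
    rw [hdiag, diagonal_apply_eq] at h
    simp_rw [hDim] at h
    have h' : hN.eigenvalues i = ∑ j, μ j * D i j := by exact_mod_cast h
    simp_rw [h', mul_comm]
  have hdet : N.det.re = ∏ i, hN.eigenvalues i := by
    rw [hN.det_eq_prod_eigenvalues]
    simp only [Complex.coe_algebraMap]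
    rw [← Complex.ofReal_prod, Complex.ofReal_re]
  rw [hdet]
  -- Column sums split each `μ j` into powers; row sums permit weighted AM-GM for each eigenvalue.
  calc ∏ j, μ j = ∏ j, ∏ i, μ j ^ D i j := by
        refine Finset.prod_congr rfl fun j _ => ?_
        rw [← Real.rpow_sum_of_nonneg (hμ j) fun i _ => hD0 i j, hcol, Real.rpow_one]
    _ = ∏ i, ∏ j, μ j ^ D i j := Finset.prod_comm
    _ ≤ ∏ i, ∑ j, D i j * μ j := by
        refine Finset.prod_le_prod
          (fun i _ => Finset.prod_nonneg fun j _ => Real.rpow_nonneg (hμ j) _) fun i _ => ?_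
        exact Real.geom_mean_le_arith_mean_weighted _ _ _ (fun j _ => hD0 i j) (hrow i)
          fun j _ => hμ j
    _ = ∏ i, hN.eigenvalues i := by simp_rw [heig]

/-- Spectral decomposition of a Hermitian matrix into rank one projections. -/
theorem Matrix.IsHermitian.exists_spectral_decomposition {n : Type*} [Fintype n] [DecidableEq n]
    {A : Matrix n n ℂ} (hA : A.IsHermitian) :
    ∃ v : n → n → ℂ, A = ∑ j, (hA.eigenvalues j : ℂ) • vecMulVec (v j) (star (v j)) ∧
      ∑ j, vecMulVec (v j) (star (v j)) = 1 ∧ ∀ j, ∑ i, v j i * star (v j i) = 1 := by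
  set U : Matrix n n ℂ := (hA.eigenvectorUnitary).1 with hU
  have h1 : Uᴴ * U = 1 := by
    rw [← star_eq_conjTranspose, hU]; exact Unitary.coe_star_mul_self _
  have h2 : U * Uᴴ = 1 := by
    rw [← star_eq_conjTranspose, hU]; exact Unitary.coe_mul_star_self _
  have h3 : A = U * diagonal (fun i => (hA.eigenvalues i : ℂ)) * Uᴴ := by
    have := hA.spectral_theorem
    rw [Unitary.conjStarAlgAut_apply] at this
    exact this
  refine ⟨fun j i => U i j, ?_, ?_, fun j => ?_⟩
  · conv_lhs => rw [h3]
    ext a b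
    rw [mul_apply, Matrix.sum_apply]
    refine Finset.sum_congr rfl fun j _ => ?_
    simp [mul_diagonal, vecMulVec_apply]
    ring
  · rw [← h2]
    ext a b
    rw [mul_apply, Matrix.sum_apply]
    simp [vecMulVec_apply]
  · have := congrFun (congrFun h1 j) j
    rw [mul_apply, one_apply_eq] at this
    rw [← this]
    simp [mul_comm]

/-- Oppenheim's inequality for a positive semidefinite matrix with unit diagonal. -/
theorem det_re_le_det_hadamard_re {n : Type*} [Fintype n] [DecidableEq n]
    {A M : Matrix n n ℂ} (hA : A.PosSemidef) (hdiag : ∀ i, A i i = 1) (hM : M.PosSemidef) :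
    M.det.re ≤ (A ⊙ M).det.re := by
  obtain ⟨v, hMv, hsum, hnorm⟩ := hM.1.exists_spectral_decomposition
  have hdet : M.det.re = ∏ i, hM.1.eigenvalues i := by
    rw [hM.1.det_eq_prod_eigenvalues]
    simp only [Complex.coe_algebraMap]
    rw [← Complex.ofReal_prod, Complex.ofReal_re]
  rw [hdet]
  -- The resolution is `A ⊙ v_j v_jᴴ`: positive by Schur's product theorem, while the unit diagonal
  -- of `A` gives trace one and sum `A ⊙ 1 = 1`.
  refine prod_le_det_of_resolution (hA.hadamard hM).1 _ hM.eigenvalues_nonneg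
    (fun j => A ⊙ vecMulVec (v j) (star (v j)))
    (fun j => hA.hadamard (posSemidef_vecMulVec_self_star _)) ?_ (fun j => ?_) ?_
  · ext a b
    have := congrFun (congrFun hsum a) b
    rw [Matrix.sum_apply] at this ⊢
    simp only [hadamard_apply, ← Finset.mul_sum, this]
    by_cases h : a = b
    · subst h; simp [hdiag]
    · simp [h]
  · simp only [trace, diag_apply, hadamard_apply, hdiag, one_mul, vecMulVec_apply, Pi.star_apply]
    exact hnorm j
  · ext a b
    have := congrFun (congrFun hMv a) b
    rw [Matrix.sum_apply] at this ⊢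
    simp only [hadamard_apply, Matrix.smul_apply, smul_eq_mul] at this ⊢
    rw [this, Finset.mul_sum]
    exact Finset.sum_congr rfl fun j _ => by ring

/-! ### Bounds by the largest eigenvalue and in Hilbert–Schmidt norm -/

theorem posSemidef_lambdaMax_smul_one_sub {n : Type*} [Fintype n] [DecidableEq n]
    {A : Matrix n n ℂ} (hA : A.IsHermitian) :
    (((lambdaMax A : ℝ) : ℂ) • (1 : Matrix n n ℂ) - A).PosSemidef := by
  obtain ⟨v, hAv, hsum, -⟩ := hA.exists_spectral_decomposition
  have h : ((lambdaMax A : ℝ) : ℂ) • (1 : Matrix n n ℂ) - A =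
      ∑ j, (((lambdaMax A - hA.eigenvalues j : ℝ)) : ℂ) • vecMulVec (v j) (star (v j)) := by
    simp_rw [Complex.ofReal_sub, sub_smul, Finset.sum_sub_distrib, ← Finset.smul_sum, hsum]
    rw [← hAv]
  rw [h]
  refine posSemidef_sum _ fun j _ => (posSemidef_vecMulVec_self_star _).smul ?_
  have : hA.eigenvalues j ≤ lambdaMax A :=
    le_csSup (finite_real_spectrum (A := A)).bddAbove (hA.eigenvalues_mem_spectrum_real j)
  exact_mod_cast sub_nonneg.2 this

/-- The quadratic form of a Hermitian matrix is bounded by its largest eigenvalue. -/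
theorem re_dotProduct_mulVec_le_lambdaMax {n : Type*} [Fintype n] [DecidableEq n]
    {A : Matrix n n ℂ} (hA : A.IsHermitian) (x : n → ℂ) :
    (star x ⬝ᵥ (A *ᵥ x)).re ≤ lambdaMax A * ∑ i, Complex.normSq (x i) := by
  have h := (posSemidef_lambdaMax_smul_one_sub hA).re_dotProduct_nonneg x
  have h2 : (star x ⬝ᵥ x) = ((∑ i, Complex.normSq (x i) : ℝ) : ℂ) := by
    simp only [dotProduct, Complex.ofReal_sum, Complex.normSq_eq_conj_mul_self, Pi.star_apply]
    rfl
  rw [sub_mulVec, dotProduct_sub, smul_mulVec, one_mulVec, dotProduct_smul, h2] at h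
  simp only [smul_eq_mul, ← Complex.ofReal_mul] at h
  simpa using h

/-- Positivity of the form at `x - z`, with `z = star y`, bounds twice the cross term by the sum of
the two diagonal terms. No conjugate falls on `y` because correlation matrices of product states are
`u vᵀ`. -/
theorem re_dotProduct_mulVec_le_lambdaMax_of_norm_le_one {n : Type*} [Fintype n] [DecidableEq n]
    {A : Matrix n n ℂ} (hA : A.PosSemidef) (h0 : 0 ≤ lambdaMax A) (x y : n → ℂ)
    (hx : ∑ i, Complex.normSq (x i) ≤ 1) (hy : ∑ i, Complex.normSq (y i) ≤ 1) :
    (y ⬝ᵥ (A *ᵥ x)).re ≤ lambdaMax A := by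
  set z : n → ℂ := star y with hz
  have hyz : y = star z := by simp [hz]
  have hzn : ∑ i, Complex.normSq (z i) ≤ 1 := by
    simpa [hz, Complex.normSq_conj] using hy
  have h1 := re_dotProduct_mulVec_le_lambdaMax hA.1 x
  have h2 := re_dotProduct_mulVec_le_lambdaMax hA.1 z
  have h3 := hA.re_dotProduct_nonneg (x - z)
  have h4 : (star x ⬝ᵥ (A *ᵥ z)).re = (star z ⬝ᵥ (A *ᵥ x)).re := by
    have : star (star z ⬝ᵥ (A *ᵥ x)) = star x ⬝ᵥ (A *ᵥ z) := by
      rw [← star_dotProduct_star, star_star, star_mulVec, hA.1.eq, ← dotProduct_mulVec]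
    rw [← this]; simp
  have e : star (x - z) ⬝ᵥ (A *ᵥ (x - z)) = star x ⬝ᵥ (A *ᵥ x) - star x ⬝ᵥ (A *ᵥ z)
      - star z ⬝ᵥ (A *ᵥ x) + star z ⬝ᵥ (A *ᵥ z) := by
    rw [star_sub, mulVec_sub, sub_dotProduct, dotProduct_sub, dotProduct_sub]; ring
  rw [e] at h3
  simp only [RCLike.re_to_complex, Complex.add_re, Complex.sub_re] at h3
  rw [hyz]
  nlinarith [mul_le_mul_of_nonneg_left hx h0, mul_le_mul_of_nonneg_left hzn h0]

/-- Bessel's inequality for the Hilbert–Schmidt inner product. -/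
theorem sum_normSq_trace_mul_le {n ι : Type*} [Fintype n] [Fintype ι] [DecidableEq ι]
    (G : ι → Matrix n n ℂ) (hG : ∀ a b, ((G a)ᴴ * G b).trace = if a = b then 1 else 0)
    (σ : Matrix n n ℂ) :
    ∑ a, Complex.normSq (σ * G a).trace ≤ ∑ i, ∑ j, Complex.normSq (σ i j) := by
  set e : ι → EuclideanSpace ℂ (n × n) := fun a => WithLp.toLp 2 fun p => G a p.1 p.2 with he
  -- This is `σᴴ` as a vector, so its inner product with `e a` is the conjugate of `Tr (σ G_a)`.
  set x : EuclideanSpace ℂ (n × n) := WithLp.toLp 2 fun p => star (σ p.2 p.1) with hx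
  have hon : Orthonormal ℂ e := by
    rw [orthonormal_iff_ite]
    intro a b
    rw [← hG a b]
    simp only [he, EuclideanSpace.inner_toLp_toLp, dotProduct, trace, diag_apply, mul_apply,
      conjTranspose_apply, Pi.star_apply, Fintype.sum_prod_type]
    rw [Finset.sum_comm]
    exact Finset.sum_congr rfl fun i _ => Finset.sum_congr rfl fun j _ => mul_comm _ _
  have hb := hon.sum_inner_products_le x (s := Finset.univ)
  have h1 : ∀ a, ‖inner ℂ (e a) x‖ ^ 2 = Complex.normSq (σ * G a).trace := fun a => by
    have : inner ℂ (e a) x = star (σ * G a).trace := by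
      simp only [he, hx, EuclideanSpace.inner_toLp_toLp, dotProduct, trace, diag_apply, mul_apply,
        Pi.star_apply, Fintype.sum_prod_type, star_sum, star_mul']
      rw [Finset.sum_comm]
    rw [this, norm_star, Complex.normSq_eq_norm_sq]
  have h2 : ‖x‖ ^ 2 = ∑ i, ∑ j, Complex.normSq (σ i j) := by
    rw [EuclideanSpace.norm_sq_eq, Fintype.sum_prod_type, Finset.sum_comm]
    simp [hx, Complex.normSq_eq_norm_sq]
  rw [← h2]
  simpa only [h1] using hb

/-- The principal minor on rows `i`, `j` is nonnegative. -/
theorem Matrix.PosSemidef.normSq_apply_le {n : Type*} {σ : Matrix n n ℂ} (h : σ.PosSemidef)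
    (i j : n) : Complex.normSq (σ i j) ≤ (σ i i).re * (σ j j).re := by
  have hd := (h.submatrix ![i, j]).det_nonneg
  have hij : σ j i = star (σ i j) := (h.1.apply j i).symm
  have hi := Complex.nonneg_iff.1 (h.diag_nonneg (i := i))
  have hd := (Complex.nonneg_iff.1 hd).1
  rw [det_fin_two] at hd
  simp only [submatrix_apply, cons_val_zero, cons_val_one, hij, Complex.sub_re, Complex.mul_re,
    ← hi.2, Complex.star_def, Complex.conj_re, Complex.conj_im] at hd
  rw [Complex.normSq_apply]
  linarith

theorem IsDensity.sum_normSq_le_one {n : Type*} [Fintype n] {σ : Matrix n n ℂ}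
    (h : IsDensity σ) : ∑ i, ∑ j, Complex.normSq (σ i j) ≤ 1 := by
  have ht : ∑ i, (σ i i).re = 1 := by
    have := congrArg Complex.re h.2
    simpa [trace] using this
  calc ∑ i, ∑ j, Complex.normSq (σ i j) ≤ ∑ i, ∑ j, (σ i i).re * (σ j j).re :=
        Finset.sum_le_sum fun i _ => Finset.sum_le_sum fun j _ => h.1.normSq_apply_le i j
    _ = 1 := by simp_rw [← Finset.mul_sum, ht, mul_one, ht]

theorem IsDensity.lambdaMax_pos {n : Type*} [Fintype n] [DecidableEq n] {ρ : Matrix n n ℂ}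
    (h : IsDensity ρ) : 0 < lambdaMax ρ := by
  have ht := (posSemidef_lambdaMax_smul_one_sub h.1.1).trace_nonneg
  rw [trace_sub, trace_smul, trace_one, h.2] at ht
  have ht := (Complex.nonneg_iff.1 ht).1
  simp at ht
  by_contra hl
  have : lambdaMax ρ * (Fintype.card n : ℝ) ≤ 0 :=
    mul_nonpos_of_nonpos_of_nonneg (not_lt.1 hl) (Nat.cast_nonneg _)
  linarith

/-! ### The two inequalities for separable states -/

theorem IsSeparableState.exists_convex_combination {d : ℕ} {ρ : BipartiteOp d}
    (h : IsSeparableState ρ) :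
    ∃ (ι : Type) (_ : Fintype ι) (w : ι → ℝ) (σ τ : ι → Matrix (Fin d) (Fin d) ℂ),
      (∀ i, 0 ≤ w i) ∧ ∑ i, w i = 1 ∧ (∀ i, IsDensity (σ i)) ∧ (∀ i, IsDensity (τ i)) ∧
        ρ = ∑ i, w i • (σ i ⊗ₖ τ i) := by
  obtain ⟨ι, _, w, z, hw, hw1, hz, rfl⟩ := mem_convexHull_iff_exists_fintype.1 h
  choose σ τ hσ hτ hz using hz
  exact ⟨ι, _, w, σ, τ, hw, hw1, hσ, hτ, by simp_rw [hz]⟩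

theorem IsSeparableState.isDensity {d : ℕ} {ρ : BipartiteOp d} (h : IsSeparableState ρ) :
    IsDensity ρ := by
  obtain ⟨ι, _, w, σ, τ, hw, hw1, hσ, hτ, rfl⟩ := h.exists_convex_combination
  refine ⟨posSemidef_sum _ fun i _ => ((hσ i).1.kronecker (hτ i).1).smul (hw i), ?_⟩
  simp_rw [trace_sum, trace_smul, trace_kronecker, (hσ _).2, (hτ _).2]
  simp only [mul_one, Complex.real_smul]
  exact_mod_cast hw1

/-- The realignment bound: for separable `P`, the correlation matrix has trace norm at most one. -/
theorem IsSeparableState.re_trace_correlationMatrix_mul_le {d : ℕ} [NeZero d]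
    {GA GB : Fin d × Fin d → Matrix (Fin d) (Fin d) ℂ} (hA : IsCanonicalBasis GA)
    (hB : IsCanonicalBasis GB) {P ρ : BipartiteOp d} (hP : IsSeparableState P)
    (hρ : IsDensity ρ) : (correlationMatrix GA GB P * ρ).trace.re ≤ lambdaMax ρ := by
  obtain ⟨ι, _, w, σ, τ, hw, hw1, hσ, hτ, rfl⟩ := hP.exists_convex_combination
  have hC : correlationMatrix GA GB (∑ i, w i • (σ i ⊗ₖ τ i)) =
      ∑ i, w i • vecMulVec (fun a => (σ i * GA a).trace) (fun b => (τ i * GB b).trace) := by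
    ext a b
    simp only [correlationMatrix, of_apply, Finset.sum_mul, trace_sum, smul_mul, trace_smul,
      ← mul_kronecker_mul, trace_kronecker, Matrix.sum_apply, Matrix.smul_apply, vecMulVec_apply]
  have key : ∀ i, (vecMulVec (fun a => (σ i * GA a).trace) (fun b => (τ i * GB b).trace)
      * ρ).trace.re ≤ lambdaMax ρ := fun i => by
    rw [vecMulVec_mul, trace_vecMulVec, dotProduct_comm, ← dotProduct_mulVec]
    exact re_dotProduct_mulVec_le_lambdaMax_of_norm_le_one hρ.1 hρ.lambdaMax_pos.le _ _
      ((sum_normSq_trace_mul_le GA hA.orthonormal _).trans (hσ i).sum_normSq_le_one)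
      ((sum_normSq_trace_mul_le GB hB.orthonormal _).trans (hτ i).sum_normSq_le_one)
  rw [hC, Finset.sum_mul, trace_sum, Complex.re_sum]
  calc _ ≤ ∑ i, w i * lambdaMax ρ := Finset.sum_le_sum fun i _ => by
        rw [smul_mul, trace_smul, Complex.real_smul, Complex.re_ofReal_mul]
        exact mul_le_mul_of_nonneg_left (key i) (hw i)
    _ = lambdaMax ρ := by rw [← Finset.sum_mul, hw1, one_mul]

/-- The value of `det (1 + ·)` can only grow from a marginal to the whole state, if the state is
the mixture of the products of unit vectors (columns of `A`) and columns of `B`. -/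
theorem det_one_add_le_det_one_add_columns {l m K : Type*} [Fintype l] [Fintype m] [Fintype K]
    [DecidableEq l] [DecidableEq m] [DecidableEq K] (A : Matrix l K ℂ) (B : Matrix m K ℂ)
    (hA : ∀ k, (Aᴴ * A) k k = 1) (X : Matrix (l × m) K ℂ)
    (hX : ∀ p k, X p k = A p.1 k * B p.2 k) :
    (1 + B * Bᴴ).det.re ≤ (1 + X * Xᴴ).det.re := by
  -- Sylvester's identity moves both determinants to Gram matrices indexed by `K`, where tensor
  -- products of columns become Hadamard products.
  rw [det_one_add_mul_comm, det_one_add_mul_comm X]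
  have h : 1 + Xᴴ * X = (Aᴴ * A) ⊙ (1 + Bᴴ * B) := by
    have hXX : Xᴴ * X = (Aᴴ * A) ⊙ (Bᴴ * B) := by
      ext k k'
      simp only [mul_apply, hadamard_apply, conjTranspose_apply, hX, Fintype.sum_prod_type,
        Finset.sum_mul_sum, star_mul']
      exact Finset.sum_congr rfl fun i _ => Finset.sum_congr rfl fun j _ => by ring
    have h1 : (Aᴴ * A) ⊙ (1 : Matrix K K ℂ) = 1 := by
      rw [hadamard_one]
      ext k k'
      by_cases hk : k = k'
      · subst hk; simp [hA]
      · simp [hk]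
    rw [hadamard_add, h1, hXX]
  rw [h]
  exact det_re_le_det_hadamard_re (posSemidef_conjTranspose_mul_self A) hA
    (PosSemidef.one.add (posSemidef_conjTranspose_mul_self B))

theorem IsSeparableState.kConst_re_nonpos {d : ℕ} {ρ : BipartiteOp d} (h : IsSeparableState ρ) :
    (kConst ρ).re ≤ 0 := by
  classical
  obtain ⟨ι, _, w, σ, τ, hw, hw1, hσ, hτ, hρ⟩ := h.exists_convex_combination
  choose s hs _ hsn using fun q => (hσ q).1.1.exists_spectral_decomposition
  choose t ht _ _ using fun q => (hτ q).1.1.exists_spectral_decomposition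
  -- Weights of the pure product states obtained by diagonalizing every `σ q` and `τ q`. Their
  -- square roots go into `B` alone, so that the columns of `A` stay unit vectors.
  set c : ι × Fin d × Fin d → ℝ := fun k =>
    w k.1 * (hσ k.1).1.1.eigenvalues k.2.1 * (hτ k.1).1.1.eigenvalues k.2.2 with hc
  have hc0 : ∀ k, 0 ≤ c k := fun k =>
    mul_nonneg (mul_nonneg (hw _) ((hσ _).1.eigenvalues_nonneg _)) ((hτ _).1.eigenvalues_nonneg _)
  have hcs : ∀ k, (√(c k) : ℂ) * √(c k) = c k := fun k => by
    rw [← Complex.ofReal_mul, Real.mul_self_sqrt (hc0 k)]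
  set A : Matrix (Fin d) (ι × Fin d × Fin d) ℂ := of fun i k => s k.1 k.2.1 i with hA
  set B : Matrix (Fin d) (ι × Fin d × Fin d) ℂ :=
    of fun j k => (√(c k) : ℂ) * t k.1 k.2.2 j with hB
  set X : Matrix (Fin d × Fin d) (ι × Fin d × Fin d) ℂ :=
    of fun p k => A p.1 k * B p.2 k with hX
  have hAA : ∀ k, (Aᴴ * A) k k = 1 := fun k => by
    rw [← hsn k.1 k.2.1]
    simp only [mul_apply, conjTranspose_apply, hA, of_apply]
    exact Finset.sum_congr rfl fun _ _ => mul_comm _ _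
  have hρX : ρ = X * Xᴴ := by
    rw [hρ]
    ext ⟨i, j⟩ ⟨i', j'⟩
    simp only [Matrix.sum_apply, Matrix.smul_apply, kroneckerMap_apply, mul_apply,
      Fintype.sum_prod_type]
    refine Finset.sum_congr rfl fun q _ => ?_
    have e1 := congrFun (congrFun (hs q) i) i'
    have e2 := congrFun (congrFun (ht q) j) j'
    rw [Matrix.sum_apply] at e1 e2
    rw [e1, e2, Finset.sum_mul_sum, Finset.smul_sum]
    refine Finset.sum_congr rfl fun m _ => ?_
    rw [Finset.smul_sum]
    refine Finset.sum_congr rfl fun n _ => ?_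
    have e3 := hcs (q, m, n)
    simp only [hX, hA, hB, of_apply, conjTranspose_apply, Matrix.smul_apply, vecMulVec_apply,
      Pi.star_apply, smul_eq_mul, star_mul', Complex.star_def, Complex.conj_ofReal,
      Complex.real_smul]
    have e4 : (c (q, m, n) : ℂ) = w q * (hσ q).1.1.eigenvalues m * (hτ q).1.1.eigenvalues n := by
      simp [hc]
    rw [e4] at e3
    linear_combination (-(s q m i * t q n j * (starRingEnd ℂ) (s q m i') *
      (starRingEnd ℂ) (t q n j'))) * e3
  have hpt : partialTraceA ρ = B * Bᴴ := by
    rw [hρX]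
    ext j j'
    simp only [partialTraceA, of_apply, mul_apply, conjTranspose_apply, hX]
    rw [Finset.sum_comm]
    refine Finset.sum_congr rfl fun k _ => ?_
    have := hAA k
    simp only [mul_apply, conjTranspose_apply] at this
    calc _ = (∑ i, star (A i k) * A i k) * (B j k * star (B j' k)) := by
          rw [Finset.sum_mul]
          exact Finset.sum_congr rfl fun i _ => by rw [star_mul']; ring
      _ = _ := by rw [this, one_mul]
  rw [kConst, hpt, hρX, Complex.sub_re, sub_nonpos]
  exact det_one_add_le_det_one_add_columns A B hAA X fun p k => rfl

/-! ### Expectation and Hermiticity of the witness -/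

theorem expectation_wCCNR {d : ℕ} (GA GB : Fin d × Fin d → Matrix (Fin d) (Fin d) ℂ)
    {ρ : BipartiteOp d} (hρ : ρ.trace = 1) :
    expectation (wCCNR GA GB ρ) ρ = 1 - (d : ℝ) ^ 2 * ((d : ℝ) + 1) ^ 2 * (kConst ρ).re
      - (lambdaMax ρ)⁻¹ * (correlationMatrix GA GB ρ * ρ).trace.re := by
  have h : ((d : ℂ) ^ 2 * ((d : ℂ) + 1) ^ 2) = (((d : ℝ) ^ 2 * ((d : ℝ) + 1) ^ 2 : ℝ) : ℂ) := by
    push_cast; rfl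
  rw [expectation, wCCNR, sub_mul, smul_mul, smul_mul, one_mul, trace_sub, trace_smul, trace_smul,
    hρ, smul_eq_mul, smul_eq_mul, mul_one, h, Complex.sub_re, Complex.sub_re,
    Complex.re_ofReal_mul, Complex.re_ofReal_mul, Complex.one_re]

theorem IsSeparableState.expectation_wCCNR_nonneg {d : ℕ} [NeZero d]
    {GA GB : Fin d × Fin d → Matrix (Fin d) (Fin d) ℂ} (hA : IsCanonicalBasis GA)
    (hB : IsCanonicalBasis GB) {ρ : BipartiteOp d} (h : IsSeparableState ρ) :
    0 ≤ expectation (wCCNR GA GB ρ) ρ := by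
  have hρ := h.isDensity
  rw [expectation_wCCNR _ _ hρ.2]
  have h1 := h.re_trace_correlationMatrix_mul_le hA hB hρ
  have h2 : (lambdaMax ρ)⁻¹ * (correlationMatrix GA GB ρ * ρ).trace.re ≤ 1 := by
    rw [inv_mul_le_iff₀ hρ.lambdaMax_pos, mul_one]; exact h1
  have h3 : (d : ℝ) ^ 2 * ((d : ℝ) + 1) ^ 2 * (kConst ρ).re ≤ 0 :=
    mul_nonpos_of_nonneg_of_nonpos (by positivity) h.kConst_re_nonpos
  linarith

theorem kConst_im {d : ℕ} {ρ : BipartiteOp d} (h : ρ.IsHermitian) : (kConst ρ).im = 0 := by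
  have hd : ∀ {n : Type} [Fintype n] [DecidableEq n] (M : Matrix n n ℂ), M.IsHermitian →
      M.det.im = 0 := fun M hM => by
    rw [← Complex.conj_eq_iff_im, ← Complex.star_def, ← det_conjTranspose, hM.eq]
  have hp : (partialTraceA ρ).IsHermitian := by
    ext i j
    simp only [partialTraceA, conjTranspose_apply, of_apply, star_sum, h.apply]
  rw [kConst, Complex.sub_im, hd _ (isHermitian_one.add hp), hd _ (isHermitian_one.add h), sub_zero]

theorem isHermitian_wCCNR_iff {d : ℕ} (GA GB : Fin d × Fin d → Matrix (Fin d) (Fin d) ℂ)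
    {ρ : BipartiteOp d} (h : IsDensity ρ) :
    (wCCNR GA GB ρ).IsHermitian ↔ (correlationMatrix GA GB ρ).IsHermitian := by
  have hk : kConst ρ = (((kConst ρ).re : ℝ) : ℂ) :=
    Complex.ext (by simp) (by simp [kConst_im h.1.1])
  have hs : star (1 - (d : ℂ) ^ 2 * ((d : ℂ) + 1) ^ 2 * kConst ρ) =
      1 - (d : ℂ) ^ 2 * ((d : ℂ) + 1) ^ 2 * kConst ρ := by
    rw [hk]; simp
  have hl : (((lambdaMax ρ)⁻¹ : ℝ) : ℂ) ≠ 0 :=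
    Complex.ofReal_ne_zero.2 (inv_ne_zero h.lambdaMax_pos.ne')
  have hl' : star (((lambdaMax ρ)⁻¹ : ℝ) : ℂ) = (((lambdaMax ρ)⁻¹ : ℝ) : ℂ) :=
    Complex.conj_ofReal _
  rw [Matrix.IsHermitian, Matrix.IsHermitian, wCCNR, conjTranspose_sub, conjTranspose_smul,
    conjTranspose_smul, conjTranspose_one, hs, hl', sub_right_inj]
  exact (smul_right_injective _ hl).eq_iff

/-! ### Negativity at the maximally entangled state -/

/-- The vector `(1 / √d) ∑ i, |i i⟩`. -/
noncomputable def maxEntangledVector (d : ℕ) : Fin d × Fin d → ℂ :=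
  fun p => if p.1 = p.2 then (((√(d : ℝ))⁻¹ : ℝ) : ℂ) else 0

/-- The maximally entangled state. -/
noncomputable def maxEntangled (d : ℕ) : BipartiteOp d :=
  vecMulVec (maxEntangledVector d) (star (maxEntangledVector d))

theorem maxEntangled_apply (d : ℕ) (i i' j j' : Fin d) :
    maxEntangled d (i, i') (j, j') =
      if i = i' then (if j = j' then ((d : ℂ))⁻¹ else 0) else 0 := by
  have h : (((√(d : ℝ))⁻¹ : ℝ) : ℂ) * (((√(d : ℝ))⁻¹ : ℝ) : ℂ) = (d : ℂ)⁻¹ := by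
    rw [← Complex.ofReal_mul, ← mul_inv, Real.mul_self_sqrt (Nat.cast_nonneg d)]
    push_cast; rfl
  by_cases h1 : i = i' <;> by_cases h2 : j = j' <;>
    simp only [maxEntangled, vecMulVec_apply, maxEntangledVector, Pi.star_apply, h1, h2, if_true,
      if_false, Complex.star_def, Complex.conj_ofReal, h, zero_mul, mul_zero, map_zero]

theorem star_dotProduct_maxEntangledVector (d : ℕ) [NeZero d] :
    star (maxEntangledVector d) ⬝ᵥ maxEntangledVector d = 1 := by
  have hd : (d : ℂ) ≠ 0 := Nat.cast_ne_zero.2 (NeZero.ne d)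
  have : ∀ p : Fin d × Fin d, star (maxEntangledVector d) p * maxEntangledVector d p =
      if p.1 = p.2 then (d : ℂ)⁻¹ else 0 := fun ⟨i, j⟩ => by
    have := maxEntangled_apply d i j i j
    rw [maxEntangled, vecMulVec_apply, mul_comm] at this
    rw [this]
    by_cases h : i = j <;> simp [h]
  simp_rw [dotProduct, this, Fintype.sum_prod_type]
  simp [hd]

theorem isDensity_maxEntangled (d : ℕ) [NeZero d] : IsDensity (maxEntangled d) := by
  refine ⟨posSemidef_vecMulVec_self_star _, ?_⟩
  rw [maxEntangled, trace_vecMulVec, dotProduct_comm, star_dotProduct_maxEntangledVector]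

theorem one_le_lambdaMax_maxEntangled (d : ℕ) [NeZero d] : 1 ≤ lambdaMax (maxEntangled d) := by
  have h := re_dotProduct_mulVec_le_lambdaMax (isDensity_maxEntangled d).1.1 (maxEntangledVector d)
  have hn : ∑ i, Complex.normSq (maxEntangledVector d i) = 1 := by
    have := star_dotProduct_maxEntangledVector d
    simp only [dotProduct, Pi.star_apply, Complex.star_def, ← Complex.normSq_eq_conj_mul_self]
      at this
    exact_mod_cast this
  have hv : maxEntangled d *ᵥ maxEntangledVector d = maxEntangledVector d := by
    rw [maxEntangled, vecMulVec_mulVec, star_dotProduct_maxEntangledVector]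
    simp
  rwa [hn, mul_one, hv, star_dotProduct_maxEntangledVector, Complex.one_re] at h

theorem kConst_maxEntangled (d : ℕ) [NeZero d] :
    kConst (maxEntangled d) = (1 + (d : ℂ)⁻¹) ^ d - 2 := by
  have hp : partialTraceA (maxEntangled d) = (d : ℂ)⁻¹ • (1 : Matrix (Fin d) (Fin d) ℂ) := by
    ext i j
    simp only [partialTraceA, of_apply, maxEntangled_apply]
    by_cases h : i = j
    · subst h; simp
    · simp [h, eq_comm]
  have h1 : (1 : Matrix (Fin d) (Fin d) ℂ) + (d : ℂ)⁻¹ • (1 : Matrix (Fin d) (Fin d) ℂ) =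
      (1 + (d : ℂ)⁻¹) • 1 := by rw [add_smul, one_smul]
  -- Rank one update: the determinant is one plus the squared norm of the vector.
  have h2 : (1 + maxEntangled d).det = 2 := by
    rw [maxEntangled, vecMulVec_eq Unit, det_one_add_replicateCol_mul_replicateRow,
      star_dotProduct_maxEntangledVector]
    norm_num
  rw [kConst, hp, h1, h2, det_smul, det_one, Fintype.card_fin, mul_one]

/-- Bernoulli's inequality would only give `(1 + 1/d)^d ≥ 2`, that is `k ≥ 0`; the quadratic term
supplies the needed gap. -/
theorem second_order_le_one_add_pow {x : ℝ} (hx : 0 ≤ x) (n : ℕ) :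
    1 + n * x + n * (n - 1) / 2 * x ^ 2 ≤ (1 + x) ^ n := by
  induction n with
  | zero => simp
  | succ n ih =>
    have hn : (0 : ℝ) ≤ n * (n - 1) := by
      rcases n with _ | n
      · simp
      · push_cast; ring_nf; positivity
    rw [pow_succ (1 + x)]
    push_cast
    nlinarith [mul_le_mul_of_nonneg_right ih (by linarith : (0 : ℝ) ≤ 1 + x),
      mul_nonneg hn (pow_nonneg hx 3)]

/-- The second-order bound equals `5/2 - 1/(2d)`, which is smallest at `d = 2`. -/
theorem nine_div_four_le_one_add_inv_pow {d : ℕ} (hd : 2 ≤ d) :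
    (9 / 4 : ℝ) ≤ (1 + (d : ℝ)⁻¹) ^ d := by
  have hd' : (2 : ℝ) ≤ d := by exact_mod_cast hd
  have h := second_order_le_one_add_pow (inv_nonneg.2 (Nat.cast_nonneg (α := ℝ) d)) d
  have e : 1 + (d : ℝ) * (d : ℝ)⁻¹ + d * (d - 1) / 2 * (d : ℝ)⁻¹ ^ 2 =
      5 / 2 - (d : ℝ)⁻¹ / 2 := by
    field_simp
    ring
  have hi : (d : ℝ)⁻¹ ≤ 2⁻¹ := inv_anti₀ (by norm_num) hd'
  linarith

theorem norm_correlationMatrix_maxEntangled_le {d : ℕ} [NeZero d]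
    {GA GB : Fin d × Fin d → Matrix (Fin d) (Fin d) ℂ} (hA : IsCanonicalBasis GA)
    (hB : IsCanonicalBasis GB) (a b : Fin d × Fin d) :
    ‖correlationMatrix GA GB (maxEntangled d) a b‖ ≤ (d : ℝ)⁻¹ := by
  have hn : ∀ {G : Fin d × Fin d → Matrix (Fin d) (Fin d) ℂ}, IsCanonicalBasis G → ∀ a,
      ∑ i, ∑ j, ‖G a i j‖ ^ 2 = 1 := fun {G} hG a => by
    have := hG.orthonormal a a
    rw [if_pos rfl] at this
    simp only [trace, diag_apply, mul_apply, conjTranspose_apply, Complex.star_def,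
      ← Complex.normSq_eq_conj_mul_self] at this
    rw [Finset.sum_comm]
    simp_rw [← Complex.normSq_eq_norm_sq]
    exact_mod_cast this
  have hC : correlationMatrix GA GB (maxEntangled d) a b =
      (d : ℂ)⁻¹ * ∑ i, ∑ j, GA a i j * GB b i j := by
    simp only [correlationMatrix, of_apply, trace, diag_apply, mul_apply, Fintype.sum_prod_type,
      maxEntangled_apply, kroneckerMap_apply, Finset.mul_sum]
    simp only [ite_mul, zero_mul, Finset.sum_ite_irrel, Finset.sum_const_zero, Finset.sum_ite_eq,
      Finset.mem_univ, if_true]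
    exact Finset.sum_comm
  rw [hC, norm_mul, norm_inv, Complex.norm_natCast]
  refine mul_le_of_le_one_right (by positivity) ?_
  calc ‖∑ i, ∑ j, GA a i j * GB b i j‖ ≤ ∑ i, ∑ j, ‖GA a i j * GB b i j‖ :=
        (norm_sum_le _ _).trans (Finset.sum_le_sum fun i _ => norm_sum_le _ _)
    _ ≤ ∑ i, ∑ j, (‖GA a i j‖ ^ 2 + ‖GB b i j‖ ^ 2) / 2 := by
        refine Finset.sum_le_sum fun i _ => Finset.sum_le_sum fun j _ => ?_
        rw [norm_mul]
        linarith [two_mul_le_add_sq ‖GA a i j‖ ‖GB b i j‖]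
    _ = 1 := by
        simp_rw [← Finset.sum_div, Finset.sum_add_distrib, hn hA, hn hB]
        norm_num

theorem expectation_wCCNR_maxEntangled_neg {d : ℕ} [NeZero d] (hd : 2 ≤ d)
    {GA GB : Fin d × Fin d → Matrix (Fin d) (Fin d) ℂ} (hA : IsCanonicalBasis GA)
    (hB : IsCanonicalBasis GB) :
    expectation (wCCNR GA GB (maxEntangled d)) (maxEntangled d) < 0 := by
  have hd0 : (d : ℝ) ≠ 0 := Nat.cast_ne_zero.2 (NeZero.ne d)
  have hd' : (2 : ℝ) ≤ d := by exact_mod_cast hd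
  rw [expectation_wCCNR _ _ (isDensity_maxEntangled d).2, kConst_maxEntangled]
  have hk : ((1 + (d : ℂ)⁻¹) ^ d - 2).re = (1 + (d : ℝ)⁻¹) ^ d - 2 := by
    have : (1 + (d : ℂ)⁻¹) ^ d - 2 = (((1 + (d : ℝ)⁻¹) ^ d - 2 : ℝ) : ℂ) := by push_cast; rfl
    rw [this, Complex.ofReal_re]
  -- Only `d²` entries of `C` contribute, each at most `1/d` in modulus and weighted by `1/d`,
  -- whence the bound 1 below.
  have ht : (correlationMatrix GA GB (maxEntangled d) * maxEntangled d).trace =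
      ∑ i, ∑ j, correlationMatrix GA GB (maxEntangled d) (i, i) (j, j) * (d : ℂ)⁻¹ := by
    simp only [trace, diag_apply, mul_apply, Fintype.sum_prod_type, maxEntangled_apply]
    simp
  have hb : ‖(correlationMatrix GA GB (maxEntangled d) * maxEntangled d).trace‖ ≤ 1 := by
    rw [ht]
    calc _ ≤ ∑ i, ∑ j, ‖correlationMatrix GA GB (maxEntangled d) (i, i) (j, j) * (d : ℂ)⁻¹‖ :=
          (norm_sum_le _ _).trans (Finset.sum_le_sum fun i _ => norm_sum_le _ _)
      _ ≤ ∑ _i : Fin d, ∑ _j : Fin d, (d : ℝ)⁻¹ * (d : ℝ)⁻¹ := by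
          refine Finset.sum_le_sum fun i _ => Finset.sum_le_sum fun j _ => ?_
          rw [norm_mul, norm_inv, Complex.norm_natCast]
          exact mul_le_mul_of_nonneg_right (norm_correlationMatrix_maxEntangled_le hA hB _ _)
            (by positivity)
      _ = 1 := by simp [hd0]
  have hre := (abs_le.1 ((Complex.abs_re_le_norm _).trans hb)).1
  have hl := one_le_lambdaMax_maxEntangled d
  have hl1 : (lambdaMax (maxEntangled d))⁻¹ ≤ 1 := inv_le_one_of_one_le₀ hl
  have hl0 : 0 ≤ (lambdaMax (maxEntangled d))⁻¹ := inv_nonneg.2 (by linarith)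
  have h1 : (lambdaMax (maxEntangled d))⁻¹ *
      (correlationMatrix GA GB (maxEntangled d) * maxEntangled d).trace.re ≥ -1 := by nlinarith
  have hp := nine_div_four_le_one_add_inv_pow hd
  have h2 : (4 : ℝ) * 9 ≤ (d : ℝ) ^ 2 * ((d : ℝ) + 1) ^ 2 := by
    apply mul_le_mul <;> nlinarith
  rw [hk]
  -- The expectation is at most `1 - 36/4 + 1 = -7`.
  nlinarith

theorem isEntangled_of_expectation_wCCNR_neg {d : ℕ} [NeZero d]
    {GA GB : Fin d × Fin d → Matrix (Fin d) (Fin d) ℂ} (hA : IsCanonicalBasis GA)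
    (hB : IsCanonicalBasis GB) {ρ : BipartiteOp d} (hρ : IsDensity ρ)
    (h : expectation (wCCNR GA GB ρ) ρ < 0) : IsEntangled ρ :=
  ⟨hρ, fun hs => absurd (hs.expectation_wCCNR_nonneg hA hB) (not_le.2 h)⟩

/-! ### The two-qubit example -/

theorem inv_sqrt_two_mul_self :
    (((√(2 : ℝ))⁻¹ : ℝ) : ℂ) * (((√(2 : ℝ))⁻¹ : ℝ) : ℂ) = 1 / 2 := by
  rw [← Complex.ofReal_mul, ← mul_inv, Real.mul_self_sqrt (by norm_num)]
  norm_num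

theorem isCanonicalBasis_pauliBasis : IsCanonicalBasis pauliBasis where
  first := by
    ext i j
    fin_cases i <;> fin_cases j <;> simp [pauliBasis]
  traceless a ha := by
    obtain ⟨i, j⟩ := a
    fin_cases i <;> fin_cases j <;> simp_all [pauliBasis, trace_fin_two]
  orthonormal a b := by
    have h : ∀ P Q : Matrix (Fin 2) (Fin 2) ℂ,
        (((((√(2 : ℝ))⁻¹ : ℝ) : ℂ) • P)ᴴ * ((((√(2 : ℝ))⁻¹ : ℝ) : ℂ) • Q)).trace =
          (1 / 2) * (Pᴴ * Q).trace := fun P Q => by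
      rw [conjTranspose_smul, smul_mul, Matrix.mul_smul, trace_smul, trace_smul, smul_smul,
        Complex.star_def, Complex.conj_ofReal, inv_sqrt_two_mul_self, smul_eq_mul]
    rw [pauliBasis, pauliBasis, h]
    obtain ⟨i, j⟩ := a
    obtain ⟨i', j'⟩ := b
    fin_cases i <;> fin_cases j <;> fin_cases i' <;> fin_cases j' <;>
      simp [trace_fin_two, mul_apply, Fin.sum_univ_two] <;> norm_num

theorem rhoExample_eq : rhoExample =
    Matrix.of fun p q => ![![![![0.265822, 0], ![0, 0]], ![![0, 0.367089], ![-0.367089, 0]]],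
      ![![![0, -0.367089], ![0.367089, 0]], ![![0, 0], ![0, 0]]]] p.1 p.2 q.1 q.2 := by
  ext ⟨i, j⟩ ⟨i', j'⟩
  fin_cases i <;> fin_cases j <;> fin_cases i' <;> fin_cases j' <;> rfl

theorem isDensity_rhoExample : IsDensity rhoExample := by
  constructor
  · have h : rhoExample = (0.265822 : ℝ) • vecMulVec (Pi.single (0, 0) 1)
          (star (Pi.single (0, 0) 1)) +
        (0.367089 : ℝ) • vecMulVec (Pi.single (0, 1) 1 - Pi.single (1, 0) 1)
          (star (Pi.single (0, 1) 1 - Pi.single (1, 0) 1)) := by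
      rw [rhoExample_eq]
      ext ⟨i, j⟩ ⟨i', j'⟩
      fin_cases i <;> fin_cases j <;> fin_cases i' <;> fin_cases j' <;>
        simp [vecMulVec_apply]
    rw [h]
    exact ((posSemidef_vecMulVec_self_star _).smul (by norm_num)).add
      ((posSemidef_vecMulVec_self_star _).smul (by norm_num))
  · rw [rhoExample_eq]
    simp [trace, Fintype.sum_prod_type, Fin.sum_univ_two]
    norm_num

/-- Two parameters serve two purposes: `(1, 1)` gives `det (1 + ρ)`, and `(μ, -1)` the
characteristic polynomial. The eigenvalue `0.734178 = 2 * 0.367089` belongs to the singlet. -/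
theorem det_smul_one_add_smul_rhoExample (x y : ℂ) :
    (x • (1 : BipartiteOp 2) + y • rhoExample).det =
      (x + 0.265822 * y) * x ^ 2 * (x + 0.734178 * y) := by
  have h : x • (1 : BipartiteOp 2) + y • rhoExample =
      (!![x + y * 0.265822, 0, 0, 0;
          0, x + y * 0.367089, -(y * 0.367089), 0;
          0, -(y * 0.367089), x + y * 0.367089, 0;
          0, 0, 0, x] : Matrix (Fin (2 * 2)) (Fin (2 * 2)) ℂ).submatrix
        finProdFinEquiv finProdFinEquiv := by
    rw [rhoExample_eq]
    ext ⟨i, j⟩ ⟨i', j'⟩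
    fin_cases i <;> fin_cases j <;> fin_cases i' <;> fin_cases j' <;>
      simp [one_apply, finProdFinEquiv]
  rw [h, det_submatrix_equiv_self]
  simp [det_succ_row_zero, Fin.sum_univ_succ, Fin.succAbove]
  ring

theorem lambdaMax_rhoExample : lambdaMax rhoExample = 0.734178 := by
  have h : ∀ μ : ℝ, μ ∈ spectrum ℝ rhoExample ↔
      (μ - 0.265822) * μ ^ 2 * (μ - 0.734178) = 0 := fun μ => by
    have e : algebraMap ℝ (BipartiteOp 2) μ - rhoExample =
        (μ : ℂ) • (1 : BipartiteOp 2) + (-1 : ℂ) • rhoExample := by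
      rw [Algebra.algebraMap_eq_smul_one, neg_one_smul, sub_eq_add_neg, Complex.coe_smul]
    rw [spectrum.mem_iff, isUnit_iff_isUnit_det, isUnit_iff_ne_zero, not_not, e,
      det_smul_one_add_smul_rhoExample, ← Complex.ofReal_inj]
    push_cast
    constructor <;> intro h <;> rw [← h] <;> norm_num <;> ring
  refine IsGreatest.csSup_eq ⟨(h _).2 (by norm_num), fun μ hμ => ?_⟩
  have := (h μ).1 hμ
  simp only [mul_eq_zero, pow_eq_zero_iff, ne_eq, OfNat.ofNat_ne_zero, not_false_eq_true] at this
  rcases this with (h | h) | h <;> norm_num at h ⊢ <;> linarith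

theorem kConst_rhoExample : kConst rhoExample = 0.367089 * 0.101267 := by
  have h1 := det_smul_one_add_smul_rhoExample 1 1
  rw [one_smul, one_smul] at h1
  have h2 : 1 + partialTraceA rhoExample = !![1.632911, 0; 0, 1.367089] := by
    rw [rhoExample_eq]
    ext i j
    fin_cases i <;> fin_cases j <;> simp [partialTraceA, Fin.sum_univ_two] <;> norm_num
  rw [kConst, h1, h2, det_fin_two_of]
  norm_num

theorem correlationMatrix_rhoExample :
    correlationMatrix pauliBasis pauliBasis rhoExample =
    Matrix.of fun p q => ![![![![0.5, 0], ![0, 0.132911]], ![![0, -0.367089], ![0, 0]]],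
      ![![![0, 0], ![-0.367089, 0]], ![![0.132911, 0], ![0, -0.234178]]]] p.1 p.2 q.1 q.2 := by
  have h : ∀ P Q : Matrix (Fin 2) (Fin 2) ℂ,
      (rhoExample * (((((√(2 : ℝ))⁻¹ : ℝ) : ℂ) • P) ⊗ₖ ((((√(2 : ℝ))⁻¹ : ℝ) : ℂ) • Q))).trace =
        (1 / 2) * (0.265822 * (P 0 0 * Q 0 0) + 0.367089 * (P 0 0 * Q 1 1 + P 1 1 * Q 0 0
          - P 0 1 * Q 1 0 - P 1 0 * Q 0 1)) := fun P Q => by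
    rw [smul_kronecker, kronecker_smul, smul_smul, inv_sqrt_two_mul_self, Matrix.mul_smul,
      trace_smul, smul_eq_mul, rhoExample_eq]
    simp [trace, mul_apply, Fintype.sum_prod_type, Fin.sum_univ_two]
    ring
  ext ⟨i, j⟩ ⟨i', j'⟩
  rw [correlationMatrix, of_apply, pauliBasis, pauliBasis, h]
  fin_cases i <;> fin_cases j <;> fin_cases i' <;> fin_cases j' <;> simp <;> norm_num

theorem isHermitian_wCCNR_rhoExample :
    (wCCNR pauliBasis pauliBasis rhoExample).IsHermitian := by
  rw [isHermitian_wCCNR_iff _ _ isDensity_rhoExample, correlationMatrix_rhoExample]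
  ext ⟨i, j⟩ ⟨i', j'⟩
  rw [conjTranspose_apply]
  fin_cases i <;> fin_cases j <;> fin_cases i' <;> fin_cases j' <;>
      simp <;> rw [Complex.conj_eq_iff_im] <;> norm_num

theorem expectation_wCCNR_rhoExample :
    expectation (wCCNR pauliBasis pauliBasis rhoExample) rhoExample =
      1 - 36 * (0.367089 * 0.101267) - (0.734178)⁻¹ * (0.132911 - 2 * 0.367089 ^ 2) := by
  have ht : (correlationMatrix pauliBasis pauliBasis rhoExample * rhoExample).trace =
      ((0.132911 - 2 * 0.367089 ^ 2 : ℝ) : ℂ) := by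
    rw [correlationMatrix_rhoExample, rhoExample_eq]
    simp [trace, mul_apply, Fintype.sum_prod_type, Fin.sum_univ_two]
    norm_num
  have hk : kConst rhoExample = ((0.367089 * 0.101267 : ℝ) : ℂ) := by
    rw [kConst_rhoExample]; push_cast; rfl
  rw [expectation_wCCNR _ _ isDensity_rhoExample.2, lambdaMax_rhoExample, ht, hk,
    Complex.ofReal_re, Complex.ofReal_re]
  norm_num

theorem theorem4 :
    (∀ (d : ℕ) [NeZero d], 2 ≤ d →
      ∀ GA GB : Fin d × Fin d → Matrix (Fin d) (Fin d) ℂ,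
        IsCanonicalBasis GA → IsCanonicalBasis GB →
          (∀ ρ : BipartiteOp d, IsDensity ρ →
            ((wCCNR GA GB ρ).IsHermitian ↔ (correlationMatrix GA GB ρ).IsHermitian)) ∧
          (∀ ρ : BipartiteOp d, IsSeparableState ρ → 0 ≤ expectation (wCCNR GA GB ρ) ρ) ∧
          (∃ ρ : BipartiteOp d, IsEntangled ρ ∧ expectation (wCCNR GA GB ρ) ρ < 0)) ∧
    (IsCanonicalBasis pauliBasis ∧
      IsEntangled rhoExample ∧
      (wCCNR pauliBasis pauliBasis rhoExample).IsHermitian ∧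
      |expectation (wCCNR pauliBasis pauliBasis rhoExample) rhoExample - (-0.152209)|
        < 0.0000005) := by
  refine ⟨fun d _ hd GA GB hA hB => ⟨fun ρ hρ => isHermitian_wCCNR_iff GA GB hρ,
    fun ρ hρ => hρ.expectation_wCCNR_nonneg hA hB, maxEntangled d, ?_, ?_⟩,
    isCanonicalBasis_pauliBasis, ?_, isHermitian_wCCNR_rhoExample, ?_⟩
  · exact isEntangled_of_expectation_wCCNR_neg hA hB (isDensity_maxEntangled d)
      (expectation_wCCNR_maxEntangled_neg hd hA hB)
  · exact expectation_wCCNR_maxEntangled_neg hd hA hB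
  · refine isEntangled_of_expectation_wCCNR_neg isCanonicalBasis_pauliBasis
      isCanonicalBasis_pauliBasis isDensity_rhoExample ?_
    rw [expectation_wCCNR_rhoExample]
    norm_num
  · rw [expectation_wCCNR_rhoExample, abs_lt]
    constructor <;> norm_num
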